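/- **Setting.** Let $(\Omega,\mathcal A,P)$ be a probability space (for instance $[0,1]$ with Lebesgue measure), $F$ a distribution function with $F(0)=0$, $F(1)=1$, $\varphi_n:\{1,2,\dots\}\to(0,\infty)$ functions and $y_n=y_n(h_1,\dots,h_n)\ge 0$ functions of $n$ positive integers ($n\ge1$). Put $\delta_n(h,k,y)=\dfrac{\varphi_n(h)(1+y)}{k+\varphi_n(h)y}$. Let $(B_n)_{n\ge1}$ be positive-integer-valued random variables such that for every $n\geq 1$ almost surely $B_{n+1}\ge\varphi_n(B_n)$, and such that, for all positive integers $h_1,\dots,h_{n+1}$ with $h_{j+1}\ge\varphi_j(h_j)$ for $1\le j\le n$ and $P(B_1=h_1,\dots,B_n=h_n)>0$, $$P(B_{n+1}=h_{n+1}\mid B_1=h_1,\dots,B_n=h_n)=F\big(\delta_n(h_n,h_{n+1},y_n)\big)-F\big(\delta_n(h_n,h_{n+1}+1,y_n)\big),\qquad y_n=y_n(h_1,\dots,h_n).$$ Let $Y_n=y_n(B_1,\dots,B_n)$ and $R_n=\dfrac{B_{n+1}+\varphi_n(B_n)Y_n}{\varphi_n(B_n)(1+Y_n)}$; $(R_n)_{n\ge1}$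 is an *Oppenheim expansion sequence with related distribution function* $F$. Let $\Lambda=(\lambda_j)_{j\ge0}$ be a *good* sequence: strictly increasing, $\lambda_0=0$, $\lambda_j\ge1$ for $j\ge1$, $\lambda_j\to\infty$ and $\sup_j(\lambda_{j+1}-\lambda_j)<\infty$. Assume that for every $j\ge1$ and every $n\ge1$, almost surely $\lambda_j\varphi_n(B_n)+(\lambda_j-1)Y_n\varphi_n(B_n)$ is an integer. Let $X_n$ be the least element of $\Lambda$ greater than $R_n$. For $0<\gamma<\frac12$ put $d_n=\sum_{k=1}^nE\big[X_k1_{\{X_k\le n^\gamma\}}\big]$. For an integer $r\ge 0$ let $S_n^{r}$ be the sum of $R_1,\dots,R_n$ with the $r$ largest terms removed (it is $0$ if $r\ge n$), and for $\beta>0$ let $r_n=\lceil\beta n^{1-\gamma}\rceil$. **Theorem.** There is a constant $C>0$, not depending on $\gamma$ and $\beta$, such that the following holds for all $0<\gamma<\frac12$ and all $\beta>C$. (a) If there are constants $0<C_1<C_2$ with $C_1\le F(x)/x\le C_2$ for all $x\in(0,1]$, then $\displaystyle\lim_{n\to\infty}\frac{S_n^{r_n}}{d_n}=1$ almost surely.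 (b) If $\displaystyle\lim_{x\to0^+}\frac{F(x)}x=\alpha>0$, then $\displaystyle\lim_{n\to\infty}\frac{S_n^{r_n}}{n\log n}=\alpha\gamma$ almost surely. -/

import Mathlib

open MeasureTheory ProbabilityTheory Filter Topology

noncomputable section

namespace Oppenheim

/-- `F` is a (cumulative) distribution function on the real line. -/
structure IsDistributionFunction (F : ℝ → ℝ) : Prop where
  mono : Monotone F
  right_continuous : ∀ x, ContinuousWithinAt F (Set.Ici x) x
  tendsto_atBot : Tendsto F atBot (𝓝 0)
  tendsto_atTop : Tendsto F atTop (𝓝 1)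

/-- `δ(k) = p (1 + y) / (k + p y)`, where `p` stands for the value `φ_n(h_n)` and `y` for the
value `y_n(h_1, …, h_n)`. -/
def delta (p k y : ℝ) : ℝ := p * (1 + y) / (k + p * y)

/-- All sequences are indexed from `1` on; the value of a sequence at the index `0` is never used.
`Yvar y B n` is the random variable `Y_n = y_n(B_1, …, B_n)`. -/
def Yvar {Ω : Type*} (y : (n : ℕ) → (Fin n → ℕ+) → ℝ) (B : ℕ → Ω → ℕ+) (n : ℕ) (ω : Ω) : ℝ :=
  y n (fun i => B (i.val + 1) ω)

/-- `R_n = (B_{n+1} + φ_n(B_n) Y_n) / (φ_n(B_n) (1 + Y_n))`. -/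
def R {Ω : Type*} (φ : ℕ → ℕ+ → ℝ) (y : (n : ℕ) → (Fin n → ℕ+) → ℝ) (B : ℕ → Ω → ℕ+)
    (n : ℕ) (ω : Ω) : ℝ :=
  ((B (n + 1) ω : ℕ) + φ n (B n ω) * Yvar y B n ω) / (φ n (B n ω) * (1 + Yvar y B n ω))

/-- The event `{B_1 = h_1, …, B_n = h_n}`. -/
def history {Ω : Type*} (B : ℕ → Ω → ℕ+) (h : ℕ → ℕ+) (n : ℕ) : Set Ω :=
  {ω | ∀ i, 1 ≤ i → i ≤ n → B i ω = h i}

/-- The random digits `B_1, B_2, …` with the functions `φ_n`, `y_n` form the data of an Oppenheim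
expansion sequence `(R_n)` with related distribution function `F`. The digit sequence is almost
surely admissible, `B_{n+1} ≥ φ_n(B_n)` (equivalently `R_n ≥ 1`), and along every admissible
history of positive probability the next digit has the prescribed conditional law. -/
structure IsOppenheim {Ω : Type*} [MeasurableSpace Ω] (P : Measure Ω) (F : ℝ → ℝ)
    (φ : ℕ → ℕ+ → ℝ) (y : (n : ℕ) → (Fin n → ℕ+) → ℝ) (B : ℕ → Ω → ℕ+) : Prop where
  distribution : IsDistributionFunction F
  F_zero : F 0 = 0
  F_one : F 1 = 1
  phi_pos : ∀ n, 1 ≤ n → ∀ h, 0 < φ n h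
  y_nonneg : ∀ n, 1 ≤ n → ∀ h, 0 ≤ y n h
  measurable : ∀ n, 1 ≤ n → ∀ k : ℕ+, MeasurableSet {ω | B n ω = k}
  admissible : ∀ n, 1 ≤ n → ∀ᵐ ω ∂P, φ n (B n ω) ≤ (B (n + 1) ω : ℕ)
  conditional : ∀ n, 1 ≤ n → ∀ h : ℕ → ℕ+,
    (∀ j, 1 ≤ j → j ≤ n → φ j (h j) ≤ (h (j + 1) : ℕ)) →
    P (history B h n) ≠ 0 →
    (P[|history B h n]).real {ω | B (n + 1) ω = h (n + 1)} =
      F (delta (φ n (h n)) (h (n + 1) : ℕ) (y n (fun i => h (i.val + 1)))) -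
      F (delta (φ n (h n)) ((h (n + 1) : ℕ) + 1) (y n (fun i => h (i.val + 1))))

/-- A good sequence `Λ = (λ_j)`, `j = 0, 1, 2, …`. -/
structure IsGood (lam : ℕ → ℝ) : Prop where
  strictMono : StrictMono lam
  tendsto : Tendsto lam atTop atTop
  zero : lam 0 = 0
  one_le : ∀ j, 1 ≤ j → 1 ≤ lam j
  gaps : ∃ l : ℝ, ∀ j, lam (j + 1) - lam j ≤ l

/-- The index `j_u`: `λ_{j_u}` is the least element of `Λ` greater than `u`. -/
def index (lam : ℕ → ℝ) (u : ℝ) : ℕ := sInf {j | u < lam j}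

/-- For `u ≥ 0` the index `j_u` is the only `j ≥ 1` with `λ_{j-1} ≤ u < λ_j`
(stated with `j + 1` for `j`). -/
theorem IsGood.index_eq_iff {lam : ℕ → ℝ} (hl : IsGood lam) (u : ℝ) (j : ℕ) :
    index lam u = j + 1 ↔ lam j ≤ u ∧ u < lam (j + 1) := by
  have hne : {j | u < lam j}.Nonempty := (hl.tendsto.eventually_gt_atTop u).exists
  have hm : u < lam (index lam u) := Nat.sInf_mem hne
  constructor
  · intro h
    rw [h] at hm
    refine ⟨?_, hm⟩
    by_contra hc
    have : index lam u ≤ j := Nat.sInf_le (not_le.mp hc)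
    omega
  · rintro ⟨h1, h2⟩
    have a : index lam u ≤ j + 1 := Nat.sInf_le h2
    have b : j < index lam u := hl.strictMono.lt_iff_lt.mp (h1.trans_lt hm)
    omega

/-- The discretized sequence `X_n = λ_{j_{R_n}}` of a sequence `(R_n)`. -/
def discretize {Ω : Type*} (lam : ℕ → ℝ) (R : ℕ → Ω → ℝ) (n : ℕ) (ω : Ω) : ℝ :=
  lam (index lam (R n ω))

/-- A permutation that arranges `x 0, …, x (n-1)` in decreasing order. -/
def decreasingOrder {n : ℕ} (x : Fin n → ℝ) : Equiv.Perm (Fin n) := Tuple.sort (fun i => -x i)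

theorem decreasingOrder_antitone {n : ℕ} (x : Fin n → ℝ) : Antitone (x ∘ decreasingOrder x) := by
  intro a b hab
  have := Tuple.monotone_sort (fun i => -x i) hab
  simpa [decreasingOrder] using this

/-- The trimmed sum `S_n^r = ∑_{k=r+1}^n x_{σ(k)}` of `x_1, …, x_n`, where
`x_{σ(1)} ≥ ⋯ ≥ x_{σ(n)}`: the `r` largest terms are left out. It is `0` if `r ≥ n`. In `Fin n`
the ranks run from `0` to `n - 1`, so that rank `k` there is rank `k + 1` here. -/
def trimmedSum (x : ℕ → ℝ) (n r : ℕ) : ℝ :=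
  ∑ k : Fin n, if r ≤ k.val then
    (fun i : Fin n => x (i.val + 1)) (decreasingOrder (fun i : Fin n => x (i.val + 1)) k) else 0

/-- The trimmed sum does not depend on the choice of the ordering permutation. -/
theorem trimmedSum_eq (x : ℕ → ℝ) (n r : ℕ) (σ : Equiv.Perm (Fin n))
    (hσ : Antitone (fun k => x ((σ k).val + 1))) :
    trimmedSum x n r = ∑ k : Fin n, if r ≤ k.val then x ((σ k).val + 1) else 0 := by
  have h : (fun i : Fin n => -x (i.val + 1)) ∘ σ =
      (fun i : Fin n => -x (i.val + 1)) ∘ Tuple.sort (fun i : Fin n => -x (i.val + 1)) :=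
    Tuple.comp_sort_eq_comp_iff_monotone.mpr (fun a b hab => neg_le_neg (hσ hab))
  refine Finset.sum_congr rfl fun k _ => ?_
  have hk := congrFun h k
  simp only [Function.comp_apply, neg_inj] at hk
  simp only [decreasingOrder, hk]

/-- `d_n = ∑_{k=1}^n E[X_k 1_{X_k ≤ n^γ}]`. -/
def truncatedMean {Ω : Type*} [MeasurableSpace Ω] (P : Measure Ω) (X : ℕ → Ω → ℝ) (γ : ℝ)
    (n : ℕ) : ℝ :=
  ∑ k ∈ Finset.Icc 1 n, ∫ ω, {ω | X k ω ≤ (n : ℝ) ^ γ}.indicator (X k) ω ∂P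

/-- `r_n = ⌈β n^{1-γ}⌉`. -/
def trimming (β γ : ℝ) (n : ℕ) : ℕ := ⌈β * (n : ℝ) ^ (1 - γ)⌉₊

end Oppenheim

end

noncomputable section

namespace Oppenheim

/-! ### Trimmed sums -/

/-! Discretizing along `lam` makes the sequence i.i.d. Given the first `n` digits, with `p = φ n (B
n)` and `z = Y_n`, the event `X_n > λ_j` is `R_n ≥ λ_j`, that is `B_{n+1} ≥ k` with `k = λ_j p +
(λ_j - 1) z p`. Since `k` is an integer, the conditional digit law telescopes to `F (δ(k)) = F (1 /
λ_j)`, whatever the history (`measure_digits_inter_lt_index`). So `X_n` is independent of `B_1, …,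
B_n`, which determine the earlier `X_i` (`iIndepFun_index`). Bounded gaps give `R_n ≤ X_n ≤ R_n +
l`.

Truncate at `t = n ^ γ`. Hoeffding's bound for a deviation `n` is `exp (-2 n ^ (1 - 2γ))`, summable
because `γ < 1/2`; Borel-Cantelli thus gives the truncated sum as `d_n + O(n)`. If `F x ≤ C x`, the
expected number of `X_k > t` is eventually at most `2 C n ^ (1 - γ)`, and the same concentration
bounds the actual number by `(1 + 2 C) n ^ (1 - γ)`. For `β > 1 + 2 C` trimming removes all large
terms, and the other removed terms cost at most `r_n t = O(n)`. Hence `S_n^{r_n} = d_n + O(n)`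
(`eventually_abs_trimmedSum_sub_le`).

Finally `d_n = n (∫₀ᵗ Q - t Q(t))` with `Q` the survival function. As `Q(s)` is of order `1 / s`,
this is of order `n log n`, so the error is negligible; if `s Q(s) → α`, then `d_n ~ α γ n log n`.
-/

theorem sum_Icc_eq_sum_fin (f : ℕ → ℝ) (n : ℕ) :
    ∑ k ∈ Finset.Icc 1 n, f k = ∑ i : Fin n, f (i.val + 1) := by
  rw [Fin.sum_univ_eq_sum_range (fun i => f (i + 1)) n, Finset.range_eq_Ico,
    Finset.sum_Ico_add' (fun i => f i) 0 n 1]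
  rfl

theorem sum_Icc_eq_sum_range (f : ℕ → ℝ) (n : ℕ) :
    ∑ k ∈ Finset.Icc 1 n, f k = ∑ i ∈ Finset.range n, f (i + 1) := by
  rw [sum_Icc_eq_sum_fin, Fin.sum_univ_eq_sum_range (fun i => f (i + 1)) n]

/-- If at most `r` of the nonnegative terms `x 1, …, x n` exceed `t`, trimming the `r` largest
terms changes the sum of the terms `≤ t` by at most `r * t`. -/
theorem trimmedSum_bounds {x : ℕ → ℝ} {n r : ℕ} {t : ℝ} (ht : 0 ≤ t)
    (hx : ∀ k, 1 ≤ k → 0 ≤ x k)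
    (hr : ∑ k ∈ Finset.Icc 1 n, (if t < x k then (1 : ℝ) else 0) ≤ r) :
    ∑ k ∈ Finset.Icc 1 n, (if x k ≤ t then x k else 0) - r * t ≤ trimmedSum x n r ∧
      trimmedSum x n r ≤ ∑ k ∈ Finset.Icc 1 n, (if x k ≤ t then x k else 0) := by
  set σ := decreasingOrder (fun i : Fin n => x (i.val + 1)) with hσ
  set a : Fin n → ℝ := fun k => x ((σ k).val + 1) with ha
  have hanti : Antitone a := decreasingOrder_antitone (fun i : Fin n => x (i.val + 1))
  have ha0 : ∀ k, 0 ≤ a k := fun k => hx _ (by omega)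
  have hsum : ∀ g : ℝ → ℝ, ∑ k ∈ Finset.Icc 1 n, g (x k) = ∑ k : Fin n, g (a k) := by
    intro g
    rw [sum_Icc_eq_sum_fin (fun k => g (x k))]
    exact (Equiv.sum_comp σ (fun i : Fin n => g (x (i.val + 1)))).symm
  have hS : trimmedSum x n r = ∑ k : Fin n, if r ≤ k.val then a k else 0 := rfl
  rw [hsum (fun u => if u ≤ t then u else 0), hS]
  rw [hsum (fun u => if t < u then (1 : ℝ) else 0)] at hr
  have hsmall : ∀ k : Fin n, r ≤ k.val → a k ≤ t := by
    intro k hk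
    by_contra hc
    push Not at hc
    -- By monotonicity all ranks `0, …, k` exceed `t` as well, which is `k + 1 > r` exceedances.
    have h1 : ((k.val + 1 : ℕ) : ℝ) ≤ ∑ k : Fin n, (if t < a k then (1 : ℝ) else 0) := by
      rw [Finset.sum_boole]
      have : (Finset.Iic k) ⊆ Finset.univ.filter (fun i => t < a i) := by
        intro i hi
        simp only [Finset.mem_filter, Finset.mem_univ, true_and]
        exact hc.trans_le (hanti (Finset.mem_Iic.mp hi))
      have := Finset.card_le_card this
      rw [Fin.card_Iic] at this
      exact_mod_cast this
    have h2 := h1.trans hr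
    have h3 : k.val + 1 ≤ r := by exact_mod_cast h2
    omega
  constructor
  · rw [sub_le_iff_le_add, ← sub_le_iff_le_add', ← Finset.sum_sub_distrib]
    calc ∑ k : Fin n, ((if a k ≤ t then a k else 0) - (if r ≤ k.val then a k else 0))
        ≤ ∑ k : Fin n, (if k.val < r then t else 0) := by
          refine Finset.sum_le_sum fun k _ => ?_
          by_cases h : r ≤ k.val
          · simp [h, hsmall k h, not_lt.mpr h]
          · simp only [h, if_false, not_le.mp h, if_true, sub_zero]
            split_ifs with h'
            · exact h'
            · exact ht
      _ ≤ r * t := by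
          rw [Fin.sum_univ_eq_sum_range (fun k => if k < r then t else 0) n, ← Finset.sum_filter,
            Finset.sum_const, nsmul_eq_mul]
          refine mul_le_mul_of_nonneg_right ?_ ht
          have : (Finset.range n).filter (fun k => k < r) ⊆ Finset.range r := by
            intro i hi
            simp only [Finset.mem_filter] at hi
            exact Finset.mem_range.mpr hi.2
          have := Finset.card_le_card this
          rw [Finset.card_range] at this
          exact_mod_cast this
  · refine Finset.sum_le_sum fun k _ => ?_
    by_cases h : r ≤ k.val
    · simp [h, hsmall k h]
    · simp only [h, if_false]
      split_ifs with h'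
      · exact ha0 k
      · exact le_rfl

/-! ### Concentration -/

theorem summable_exp_neg_rpow {a c : ℝ} (ha : 0 < a) (hc : 0 < c) :
    Summable (fun n : ℕ => Real.exp (-c * (n : ℝ) ^ a)) := by
  have h1 := isLittleO_exp_neg_mul_rpow_atTop hc (-(2 / a))
  have h2 : Tendsto (fun n : ℕ => (n : ℝ) ^ a) atTop atTop :=
    (tendsto_rpow_atTop ha).comp tendsto_natCast_atTop_atTop
  have h3 := (h1.comp_tendsto h2).isBigO
  refine summable_of_isBigO_nat (g := fun n : ℕ => (n : ℝ) ^ (-2 : ℝ))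
    (Real.summable_nat_rpow.mpr (by norm_num)) (h3.congr_right fun n => ?_)
  simp only [Function.comp_apply]
  rw [← Real.rpow_mul (Nat.cast_nonneg n)]
  congr 1
  field_simp

/-- Hoeffding's inequality and the Borel-Cantelli lemma: a row-wise independent triangular array
with entries of the `n`-th row in `[0, n ^ γ]`, where `γ < 1/2`, has row sums that deviate from
their means by less than `n`, for all large `n`. -/
theorem eventually_sum_sub_integral_lt {Ω : Type*} [MeasurableSpace Ω] {P : Measure Ω}
    [IsProbabilityMeasure P] {Z : ℕ → ℕ → Ω → ℝ} {γ : ℝ} (hγ : γ < 1 / 2)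
    (hm : ∀ n k, Measurable (Z n k)) (hind : ∀ n, iIndepFun (Z n) P)
    (hb : ∀ (n k : ℕ) ω, Z n k ω ∈ Set.Icc 0 ((n : ℝ) ^ γ)) :
    ∀ᵐ ω ∂P, ∀ᶠ n : ℕ in atTop,
      ∑ k ∈ Finset.range n, Z n k ω - ∑ k ∈ Finset.range n, ∫ ω, Z n k ω ∂P < n := by
  have key : ∀ n : ℕ, 1 ≤ n →
      P.real {ω | (n : ℝ) ≤ ∑ k ∈ Finset.range n, (Z n k ω - ∫ ω, Z n k ω ∂P)} ≤
        Real.exp (-2 * (n : ℝ) ^ (1 - 2 * γ)) := by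
    intro n hn
    have hn0 : (0 : ℝ) < n := by exact_mod_cast hn
    have hi : iIndepFun (fun k ω => Z n k ω - ∫ ω, Z n k ω ∂P) P :=
      (hind n).comp (fun k u => u - ∫ ω, Z n k ω ∂P) (fun k => by fun_prop)
    -- Each summand has sub-Gaussian parameter `(n ^ γ / 2) ^ 2`, so the exponent is `-n ^ 2 / (2 n
    -- (n ^ γ / 2) ^ 2) = -2 n ^ (1 - 2γ)`.
    refine (HasSubgaussianMGF.measure_sum_range_ge_le_of_iIndepFun hi
      (c := ((‖(n : ℝ) ^ γ - 0‖₊ / 2) ^ 2))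
      (fun k _ => hasSubgaussianMGF_of_mem_Icc (hm n k).aemeasurable
        (ae_of_all _ (hb n k))) hn0.le).trans ?_
    rw [Real.exp_le_exp]
    apply le_of_eq
    have hp : 0 < (n : ℝ) ^ γ := Real.rpow_pos_of_pos hn0 _
    have h2 : (n : ℝ) ^ (1 - 2 * γ) = n / ((n : ℝ) ^ γ) ^ 2 := by
      rw [Real.rpow_sub hn0, Real.rpow_one, mul_comm 2 γ, Real.rpow_mul hn0.le]
      norm_cast
    rw [h2]
    push_cast
    rw [sub_zero, Real.norm_of_nonneg hp.le]
    field_simp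
  have hsum : Summable fun n : ℕ =>
      P.real {ω | (n : ℝ) ≤ ∑ k ∈ Finset.range n, (Z n k ω - ∫ ω, Z n k ω ∂P)} := by
    rw [← summable_nat_add_iff 1]
    refine Summable.of_nonneg_of_le (fun _ => measureReal_nonneg) (fun n => key (n + 1) (by omega))
      ((summable_nat_add_iff 1).mpr (summable_exp_neg_rpow (a := 1 - 2 * γ) (c := 2)
        (by linarith) (by norm_num)))
  have hne : ∑' n : ℕ, P {ω | (n : ℝ) ≤ ∑ k ∈ Finset.range n, (Z n k ω - ∫ ω, Z n k ω ∂P)} ≠ ⊤ := by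
    have := hsum.tsum_ofReal_ne_top
    simpa only [measureReal_def, ENNReal.ofReal_toReal (measure_ne_top P _)] using this
  filter_upwards [ae_eventually_notMem hne] with ω hω
  filter_upwards [hω] with n h
  simpa [Finset.sum_sub_distrib] using h

/-- Peel off the factor of largest index `n`: the remaining intersection lies in `m n`. The `m n`
need not be nested. -/
theorem iIndepFun_of_indepFun_prefix {Ω β : Type*} [MeasurableSpace Ω] [MeasurableSpace β]
    {P : Measure Ω} [IsProbabilityMeasure P] {X : ℕ → Ω → β} (m : ℕ → MeasurableSpace Ω)
    (hX : ∀ i n, i < n → Measurable[m n] (X i))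
    (hind : ∀ n, Indep (m n) (MeasurableSpace.comap (X n) inferInstance) P) :
    iIndepFun X P := by
  rw [iIndepFun_iff_measure_inter_preimage_eq_mul]
  intro S sets
  induction S using Finset.induction_on_max with
  | empty => simp
  | insert n S hS ih =>
    intro hs
    have hn : n ∉ S := fun h => lt_irrefl _ (hS n h)
    rw [Finset.set_biInter_insert, Finset.prod_insert hn, Set.inter_comm,
      (Indep_iff _ _ _).mp (hind n), ih (fun i hi => hs i (Finset.mem_insert_of_mem hi)), mul_comm]
    · exact Finset.measurableSet_biInter _ fun i hi =>
        hX i n (hS i hi) (hs i (Finset.mem_insert_of_mem hi))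
    · exact ⟨sets n, hs n (Finset.mem_insert_self _ _), rfl⟩

/-! ### The law of the discretized sequence -/

instance : MeasurableSpace ℕ+ := ⊤

instance : DiscreteMeasurableSpace ℕ+ := ⟨fun _ => trivial⟩

/-- The vector `(B_1, …, B_n)`. -/
def digits {Ω : Type*} (B : ℕ → Ω → ℕ+) (n : ℕ) (ω : Ω) : Fin n → ℕ+ := fun i => B (i.val + 1) ω

theorem IsGood.lt_index_iff {lam : ℕ → ℝ} (hl : IsGood lam) (j : ℕ) (u : ℝ) :
    j < index lam u ↔ lam j ≤ u := by
  have hne : {j | u < lam j}.Nonempty := (hl.tendsto.eventually_gt_atTop u).exists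
  have hm : u < lam (index lam u) := Nat.sInf_mem hne
  constructor
  · intro h
    by_contra hc
    exact absurd (Nat.sInf_le (not_le.mp hc) : index lam u ≤ j) (not_le.mpr h)
  · intro h
    exact hl.strictMono.lt_iff_lt.mp (h.trans_lt hm)

theorem IsGood.nonneg {lam : ℕ → ℝ} (hlam : IsGood lam) (j : ℕ) : 0 ≤ lam j :=
  hlam.zero.ge.trans (hlam.strictMono.monotone (Nat.zero_le j))

theorem index_R_eq_comp_digits {Ω : Type*} {φ : ℕ → ℕ+ → ℝ}
    {y : (n : ℕ) → (Fin n → ℕ+) → ℝ} {B : ℕ → Ω → ℕ+} {lam : ℕ → ℝ} {i n : ℕ} (hi : 1 ≤ i) (hin : i + 1 ≤ n) :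
    ∃ G : (Fin n → ℕ+) → ℕ, ∀ ω, index lam (R φ y B i ω) = G (digits B n ω) := by
  -- `R_i` involves only `B_1, …, B_{i+1}`; the filler value `1` is never read.
  refine ⟨fun v => index lam (R φ y
    (fun k (_ : Unit) => if h : 1 ≤ k ∧ k ≤ n then v ⟨k - 1, by omega⟩ else 1) i ()), fun ω => ?_⟩
  have hB : ∀ k, 1 ≤ k → k ≤ n →
      (if h : 1 ≤ k ∧ k ≤ n then digits B n ω ⟨k - 1, by omega⟩ else 1) = B k ω := by
    intro k h1 h2
    rw [dif_pos ⟨h1, h2⟩]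
    simp [digits, Nat.sub_add_cancel h1]
  simp only [R, Yvar]
  rw [hB i hi (by omega), hB (i + 1) (by omega) hin]
  have : (fun j : Fin i => if h : 1 ≤ j.val + 1 ∧ j.val + 1 ≤ n then
      digits B n ω ⟨j.val + 1 - 1, by omega⟩ else 1) = fun j : Fin i => B (j.val + 1) ω := by
    funext j
    exact hB (j.val + 1) (by omega) (by omega)
  rw [this]

section Law

variable {Ω : Type*} [MeasurableSpace Ω] {P : Measure Ω} {F : ℝ → ℝ} {φ : ℕ → ℕ+ → ℝ}
  {y : (n : ℕ) → (Fin n → ℕ+) → ℝ} {B : ℕ → Ω → ℕ+} {lam : ℕ → ℝ}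

theorem IsOppenheim.measurable_digit (hR : IsOppenheim P F φ y B) {n : ℕ} (hn : 1 ≤ n) :
    Measurable (B n) :=
  measurable_to_countable' fun k => hR.measurable n hn k

theorem IsOppenheim.measurable_digits (hR : IsOppenheim P F φ y B) (n : ℕ) :
    Measurable (digits B n) :=
  measurable_pi_lambda _ fun _ => hR.measurable_digit (by omega)

theorem IsOppenheim.R_pos (hR : IsOppenheim P F φ y B) {n : ℕ} (hn : 1 ≤ n) (ω : Ω) :
    0 < R φ y B n ω := by
  have h1 := hR.phi_pos n hn (B n ω)
  have h2 : 0 ≤ Yvar y B n ω := hR.y_nonneg n hn _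
  have h3 : (0 : ℝ) < ((B (n + 1) ω : ℕ) : ℝ) := by exact_mod_cast (B (n + 1) ω).pos
  unfold R
  positivity

theorem IsOppenheim.measurable_index (hR : IsOppenheim P F φ y B) {n : ℕ} (hn : 1 ≤ n) :
    Measurable fun ω => index lam (R φ y B n ω) := by
  obtain ⟨G, hG⟩ := index_R_eq_comp_digits (φ := φ) (y := y) (B := B) (lam := lam) hn le_rfl
  simp only [hG]
  exact (Measurable.of_discrete (f := G)).comp (hR.measurable_digits _)

theorem IsOppenheim.measurable_discretize (hR : IsOppenheim P F φ y B) {n : ℕ} (hn : 1 ≤ n) :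
    Measurable (discretize lam (R φ y B) n) :=
  (Measurable.of_discrete (f := lam)).comp (hR.measurable_index hn)

theorem tendsto_F_delta_add (hF : IsDistributionFunction F) (hF0 : F 0 = 0) {p z : ℝ} (hp : 0 < p)
    (hz : 0 ≤ z) (m : ℕ) :
    Tendsto (fun N : ℕ => F (delta p ((m : ℝ) + N) z)) atTop (𝓝 0) := by
  -- The limit is taken within `[0, ∞)` because `F` is only right continuous.
  have h1 : Tendsto (fun N : ℕ => delta p ((m : ℝ) + N) z) atTop (𝓝[Set.Ici 0] 0) := by
    refine tendsto_nhdsWithin_iff.mpr ⟨?_, Eventually.of_forall fun N => ?_⟩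
    · refine Tendsto.const_div_atTop ?_ _
      exact tendsto_atTop_add_const_right _ _
        (tendsto_atTop_add_const_left _ _ tendsto_natCast_atTop_atTop)
    · simp only [delta, Set.mem_Ici]
      positivity
  have h2 := (hF.right_continuous 0).tendsto.comp h1
  rwa [hF0] at h2

theorem IsOppenheim.measurableSet_history (hR : IsOppenheim P F φ y B) (h : ℕ → ℕ+) (n : ℕ) :
    MeasurableSet (history B h n) := by
  have : history B h n = ⋂ i : ℕ, ⋂ _ : 1 ≤ i, ⋂ _ : i ≤ n, {ω | B i ω = h i} := by
    ext ω; simp [history]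
  rw [this]
  exact MeasurableSet.iInter fun i => MeasurableSet.iInter fun hi => MeasurableSet.iInter fun _ =>
    hR.measurable i hi _

/-- The point probabilities telescope, and the far end tends to `F 0 = 0`. The bound `φ n (h n) ≤ m`
makes every continuation by a digit `≥ m` admissible, so the conditional law applies to each. -/
theorem IsOppenheim.cond_real_ge (hR : IsOppenheim P F φ y B) [IsProbabilityMeasure P] {n : ℕ}
    (hn : 1 ≤ n) (h : ℕ → ℕ+) (hadm : ∀ j, 1 ≤ j → j < n → φ j (h j) ≤ (h (j + 1) : ℕ))
    (hpos : P (history B h n) ≠ 0) (m : ℕ) (hm1 : 1 ≤ m) (hm : φ n (h n) ≤ m) :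
    (P[|history B h n]).real {ω | m ≤ (B (n + 1) ω : ℕ)} =
      F (delta (φ n (h n)) m (y n (fun i => h (i.val + 1)))) := by
  set p := φ n (h n) with hp
  set z := y n (fun i => h (i.val + 1)) with hz
  set μ := P[|history B h n] with hμ
  have hprob : IsProbabilityMeasure μ := cond_isProbabilityMeasure hpos
  have hatom : ∀ k : ℕ, m ≤ k → μ.real {ω | (B (n + 1) ω : ℕ) = k} =
      F (delta p k z) - F (delta p ((k : ℝ) + 1) z) := by
    intro k hk
    let k' : ℕ+ := ⟨k, by omega⟩
    let h' := Function.update h (n + 1) k'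
    have hh : ∀ j, j ≤ n → h' j = h j := fun j hj => Function.update_of_ne (by omega) _ _
    have hn1 : h' (n + 1) = k' := Function.update_self _ _ _
    have hhist : history B h' n = history B h n := by
      ext ω
      simp only [history, Set.mem_ofPred_eq]
      refine forall_congr' fun i => forall_congr' fun _ => forall_congr' fun hi => ?_
      rw [hh i hi]
    have hy : (fun i : Fin n => h' (i.val + 1)) = fun i : Fin n => h (i.val + 1) := by
      funext i
      exact hh _ (by omega)
    have := hR.conditional n hn h' (by
      intro j hj1 hj2
      rcases hj2.lt_or_eq with hj | rfl
      · rw [hh j hj2, hh (j + 1) hj]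
        exact hadm j hj1 hj
      · rw [hh j le_rfl, hn1]
        exact hm.trans (by exact_mod_cast hk)) (by rwa [hhist])
    rw [hhist, hh n le_rfl, hn1, hy] at this
    have hset : {ω | (B (n + 1) ω : ℕ) = k} = {ω | B (n + 1) ω = k'} := by
      ext ω
      simp only [Set.mem_ofPred_eq]
      exact ⟨fun e => PNat.eq e, fun e => by rw [e]; rfl⟩
    rw [hset]
    exact this
  have hmeas : ∀ s : Set ℕ, MeasurableSet {ω | (B (n + 1) ω : ℕ) ∈ s} := fun s =>
    hR.measurable_digit (n := n + 1) (by omega)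
      (MeasurableSet.of_discrete (s := {k : ℕ+ | (k : ℕ) ∈ s}))
  have hfin : ∀ N : ℕ, μ.real {ω | (B (n + 1) ω : ℕ) ∈ Set.Ico m (m + N)} =
      F (delta p m z) - F (delta p ((m : ℝ) + N) z) := by
    intro N
    induction N with
    | zero => simp
    | succ N ih =>
      have hU : {ω | (B (n + 1) ω : ℕ) ∈ Set.Ico m (m + (N + 1))} =
          {ω | (B (n + 1) ω : ℕ) ∈ Set.Ico m (m + N)} ∪ {ω | (B (n + 1) ω : ℕ) = m + N} := by
        ext ω
        simp only [Set.mem_ofPred_eq, Set.mem_Ico, Set.mem_union]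
        omega
      have hd : Disjoint {ω | (B (n + 1) ω : ℕ) ∈ Set.Ico m (m + N)}
          {ω | (B (n + 1) ω : ℕ) = m + N} := by
        rw [Set.disjoint_left]
        rintro ω ⟨_, h2⟩ h3
        simp only [Set.mem_ofPred_eq] at h3
        omega
      rw [hU, measureReal_union hd (hmeas {m + N}), ih, hatom (m + N) (by omega)]
      push_cast
      rw [← add_assoc]
      ring
  have hUn : {ω | m ≤ (B (n + 1) ω : ℕ)} =
      ⋃ N : ℕ, {ω | (B (n + 1) ω : ℕ) ∈ Set.Ico m (m + N)} := by
    ext ω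
    simp only [Set.mem_ofPred_eq, Set.mem_Ico, Set.mem_iUnion]
    exact ⟨fun e => ⟨B (n + 1) ω, e, by omega⟩, fun ⟨_, e, _⟩ => e⟩
  have hmono : Monotone fun N : ℕ => {ω | (B (n + 1) ω : ℕ) ∈ Set.Ico m (m + N)} := by
    intro a b hab ω hω
    simp only [Set.mem_ofPred_eq, Set.mem_Ico] at hω ⊢
    omega
  have ht1 := tendsto_measure_iUnion_atTop (μ := μ) hmono
  rw [← hUn] at ht1
  have ht2 := (ENNReal.tendsto_toReal (measure_ne_top μ _)).comp ht1
  have ht3 : Tendsto (fun N : ℕ => μ.real {ω | (B (n + 1) ω : ℕ) ∈ Set.Ico m (m + N)}) atTop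
      (𝓝 (F (delta p m z))) := by
    simp only [hfin]
    simpa using (tendsto_F_delta_add hR.distribution hR.F_zero (hR.phi_pos n hn (h n))
      (hR.y_nonneg n hn _) m).const_sub (F (delta p m z))
  exact tendsto_nhds_unique ht2 ht3

/-- The probability `P(X_n > λ_j)`. -/
def tail (F : ℝ → ℝ) (lam : ℕ → ℝ) (j : ℕ) : ℝ := F (1 / max 1 (lam j))

/-- The one place where integrality enters: it turns a threshold for `R_n` into an exact digit
threshold, at which the conditional tail does not depend on `v`. -/
theorem IsOppenheim.measure_digits_inter_lt_index (hR : IsOppenheim P F φ y B)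
    [IsProbabilityMeasure P] (hlam : IsGood lam)
    (hint : ∀ j, 1 ≤ j → ∀ n, 1 ≤ n → ∀ᵐ ω ∂P, ∃ m : ℤ,
      lam j * φ n (B n ω) + (lam j - 1) * Yvar y B n ω * φ n (B n ω) = m)
    {n : ℕ} (hn : 1 ≤ n) (v : Fin n → ℕ+) (j : ℕ) :
    P.real {ω | digits B n ω = v ∧ j < index lam (R φ y B n ω)} =
      P.real {ω | digits B n ω = v} * tail F lam j := by
  rcases Nat.eq_zero_or_pos j with rfl | hj
  -- For `j = 0` the event is certain, and `tail` is `F 1 = 1` thanks to the `max` in its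
  -- definition.
  · have : ∀ ω, 0 < index lam (R φ y B n ω) := fun ω =>
      (hlam.lt_index_iff 0 _).mpr (by rw [hlam.zero]; exact (hR.R_pos hn ω).le)
    simp [this, tail, hlam.zero, hR.F_one]
  have hl1 := hlam.one_le j hj
  let h : ℕ → ℕ+ := fun i => if e : 1 ≤ i ∧ i ≤ n then v ⟨i - 1, by omega⟩ else 1
  have hv : (fun i : Fin n => h (i.val + 1)) = v := by
    funext i
    simp only [h]
    rw [dif_pos ⟨by omega, by omega⟩]
    rfl
  have hhist : {ω | digits B n ω = v} = history B h n := by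
    ext ω
    simp only [Set.mem_ofPred_eq, history]
    constructor
    · rintro e i hi1 hi2
      simp only [h]
      rw [dif_pos ⟨hi1, hi2⟩, ← e]
      simp [digits, Nat.sub_add_cancel hi1]
    · intro e
      funext i
      rw [digits, e _ (by omega) (by omega)]
      exact congrFun hv i
  rw [Set.ofPred_and, hhist]
  by_cases hpos : P (history B h n) = 0
  · have : P.real (history B h n) = 0 := by simp [measureReal_def, hpos]
    rw [this, zero_mul]
    exact le_antisymm ((measureReal_mono Set.inter_subset_left).trans this.le) measureReal_nonneg
  -- A history of positive probability contains a point where the almost sure properties hold.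
  -- Integrality and admissibility up to time `n` depend on the history alone, so they hold for `h`
  -- itself.
  obtain ⟨ω₀, hω₀, hadm, k, hk⟩ : ∃ ω, ω ∈ history B h n ∧
      (∀ i, 1 ≤ i → φ i (B i ω) ≤ (B (i + 1) ω : ℕ)) ∧
      ∃ m : ℤ, lam j * φ n (B n ω) + (lam j - 1) * Yvar y B n ω * φ n (B n ω) = m := by
    have hae : ∀ᵐ ω ∂P, (∀ i, 1 ≤ i → φ i (B i ω) ≤ (B (i + 1) ω : ℕ)) ∧
        ∃ m : ℤ, lam j * φ n (B n ω) + (lam j - 1) * Yvar y B n ω * φ n (B n ω) = m := by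
      refine Eventually.and (ae_all_iff.mpr fun i => ?_) (hint j hj n hn)
      by_cases hi : 1 ≤ i
      · filter_upwards [hR.admissible i hi] with ω hω _ using hω
      · exact ae_of_all _ fun ω h => absurd h hi
    by_contra hc
    push Not at hc
    refine hpos (measure_mono_null (fun ω hω => ?_) hae)
    simp only [Set.mem_compl_iff, Set.mem_ofPred_eq]
    rintro ⟨h1, m, h2⟩
    exact hc ω hω h1 m h2
  have hY : ∀ ω ∈ history B h n, Yvar y B n ω = y n (fun i => h (i.val + 1)) := by
    intro ω hω
    rw [Yvar]
    congr 1
    funext i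
    exact hω _ (by omega) (by omega)
  rw [hY ω₀ hω₀, hω₀ n hn le_rfl] at hk
  have hp0 := hR.phi_pos n hn (h n)
  have hz0 := hR.y_nonneg n hn (fun i => h (i.val + 1))
  set p := φ n (h n) with hp
  set z := y n (fun i => h (i.val + 1)) with hz
  -- Here `k = p + (λ_j - 1) (1 + z) p`.
  have hkp : p ≤ k := by
    rw [← hk]
    nlinarith [mul_nonneg (mul_nonneg (sub_nonneg.mpr hl1) hz0) hp0.le,
      mul_nonneg (sub_nonneg.mpr hl1) hp0.le]
  have hk0 : 0 < k := by exact_mod_cast hp0.trans_le hkp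
  lift k to ℕ using hk0.le
  have hcast : (((k : ℕ) : ℤ) : ℝ) = (k : ℝ) := by push_cast; rfl
  rw [hcast] at hk hkp
  have hset : history B h n ∩ {ω | j < index lam (R φ y B n ω)} =
      history B h n ∩ {ω | k ≤ (B (n + 1) ω : ℕ)} := by
    ext ω
    simp only [Set.mem_inter_iff, Set.mem_ofPred_eq]
    refine and_congr_right fun hω => ?_
    rw [hlam.lt_index_iff, R, hY ω hω, hω n hn le_rfl, ← hp, le_div_iff₀ (by positivity),
      ← Nat.cast_le (α := ℝ), ← hk]
    constructor <;> intro h' <;> nlinarith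
  have hcond := hR.cond_real_ge hn h (fun i h1 h2 => by
    have := hadm i h1
    rwa [hω₀ i h1 h2.le, hω₀ (i + 1) (by omega) (by omega)] at this) hpos k (by omega) hkp
  rw [← hp, ← hz] at hcond
  -- Because `k + p z = λ_j p (1 + z)`.
  have hdel : delta p k z = 1 / max 1 (lam j) := by
    rw [delta, max_eq_right hl1, ← hk, div_eq_div_iff (by nlinarith) (by linarith)]
    ring
  rw [hdel, measureReal_def, cond_apply (hR.measurableSet_history h n), ENNReal.toReal_mul,
    ENNReal.toReal_inv] at hcond
  have hne : (P (history B h n)).toReal ≠ 0 := by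
    simpa [ENNReal.toReal_eq_zero_iff] using hpos
  rw [hset, tail, ← hcond, measureReal_def, measureReal_def]
  field_simp

/-- Digit vectors form a countable space, so the identity for single vectors determines both
measures. -/
theorem IsOppenheim.real_lt_index (hR : IsOppenheim P F φ y B)
    [IsProbabilityMeasure P] (hlam : IsGood lam)
    (hint : ∀ j, 1 ≤ j → ∀ n, 1 ≤ n → ∀ᵐ ω ∂P, ∃ m : ℤ,
      lam j * φ n (B n ω) + (lam j - 1) * Yvar y B n ω * φ n (B n ω) = m)
    {n : ℕ} (hn : 1 ≤ n) (A : Set (Fin n → ℕ+)) (j : ℕ) :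
    P.real {ω | digits B n ω ∈ A ∧ j < index lam (R φ y B n ω)} =
      P.real {ω | digits B n ω ∈ A} * tail F lam j := by
  have hHm := hR.measurable_digits n
  have hIm := hR.measurable_index (lam := lam) hn
  have hms : MeasurableSet {ω | j < index lam (R φ y B n ω)} :=
    hIm (MeasurableSet.of_discrete (s := Set.Ioi j))
  have ht : 0 ≤ tail F lam j := by
    have := hR.distribution.mono (a := 0) (b := 1 / max 1 (lam j)) (by positivity)
    rwa [hR.F_zero] at this
  have heq : (P.restrict {ω | j < index lam (R φ y B n ω)}).map (digits B n) =
      (ENNReal.ofReal (tail F lam j)) • P.map (digits B n) := by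
    refine Measure.ext_of_singleton fun v => ?_
    have := hR.measure_digits_inter_lt_index hlam hint hn v j
    rw [Measure.smul_apply, Measure.map_apply hHm (measurableSet_singleton v),
      Measure.map_apply hHm (measurableSet_singleton v),
      Measure.restrict_apply (hHm (measurableSet_singleton v)), smul_eq_mul,
      ← ENNReal.toReal_eq_toReal_iff' (measure_ne_top P _)
        (ENNReal.mul_ne_top ENNReal.ofReal_ne_top (measure_ne_top P _)), ENNReal.toReal_mul,
      ENNReal.toReal_ofReal ht, mul_comm]
    exact this
  have hA : MeasurableSet A := MeasurableSet.of_discrete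
  have := congrArg (fun μ => (μ A).toReal) heq
  simp only [Measure.smul_apply, Measure.map_apply hHm hA, Measure.restrict_apply (hHm hA),
    smul_eq_mul, ENNReal.toReal_mul, ENNReal.toReal_ofReal ht] at this
  rw [mul_comm]
  exact this

theorem IsOppenheim.real_lt_index_eq_tail (hR : IsOppenheim P F φ y B)
    [IsProbabilityMeasure P] (hlam : IsGood lam)
    (hint : ∀ j, 1 ≤ j → ∀ n, 1 ≤ n → ∀ᵐ ω ∂P, ∃ m : ℤ,
      lam j * φ n (B n ω) + (lam j - 1) * Yvar y B n ω * φ n (B n ω) = m)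
    {n : ℕ} (hn : 1 ≤ n) (j : ℕ) :
    P.real {ω | j < index lam (R φ y B n ω)} = tail F lam j := by
  simpa using hR.real_lt_index hlam hint hn Set.univ j

theorem IsOppenheim.indepFun_digits_index (hR : IsOppenheim P F φ y B)
    [IsProbabilityMeasure P] (hlam : IsGood lam)
    (hint : ∀ j, 1 ≤ j → ∀ n, 1 ≤ n → ∀ᵐ ω ∂P, ∃ m : ℤ,
      lam j * φ n (B n ω) + (lam j - 1) * Yvar y B n ω * φ n (B n ω) = m)
    {n : ℕ} (hn : 1 ≤ n) :
    IndepFun (digits B n) (fun ω => index lam (R φ y B n ω)) P := by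
  have hHm := hR.measurable_digits n
  have hIm := hR.measurable_index (lam := lam) hn
  have hmarg := hR.real_lt_index_eq_tail hlam hint hn
  rw [indepFun_iff_measure_inter_preimage_eq_mul]
  intro A S _ _
  have hA : MeasurableSet (digits B n ⁻¹' A) := hHm MeasurableSet.of_discrete
  have heq : (P.restrict (digits B n ⁻¹' A)).map (fun ω => index lam (R φ y B n ω)) =
      P (digits B n ⁻¹' A) • P.map (fun ω => index lam (R φ y B n ω)) := by
    refine Measure.ext_of_Ici _ _ fun j => ?_
    rw [Measure.smul_apply, Measure.map_apply hIm measurableSet_Ici,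
      Measure.map_apply hIm measurableSet_Ici, Measure.restrict_apply (hIm measurableSet_Ici),
      smul_eq_mul]
    rcases j with _ | j
    · have : Set.Ici 0 = (Set.univ : Set ℕ) := Set.Ici_bot
      simp [this]
    · have h1 := hR.real_lt_index hlam hint hn A j
      rw [← hmarg] at h1
      rw [← ENNReal.toReal_eq_toReal_iff' (measure_ne_top P _)
        (ENNReal.mul_ne_top (measure_ne_top P _) (measure_ne_top P _)), ENNReal.toReal_mul,
        Set.inter_comm]
      exact h1
  have := congrArg (fun μ => μ S) heq
  simp only [Measure.smul_apply, Measure.map_apply hIm MeasurableSet.of_discrete, smul_eq_mul,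
    Measure.restrict_apply (hIm MeasurableSet.of_discrete)] at this
  rw [Set.inter_comm, this]

/-- With the shift by one, the digits `B_1, …, B_{n+1}` determine the entries before `n`, and entry
`n`, the index of `R_{n+1}`, is independent of them. -/
theorem IsOppenheim.iIndepFun_index (hR : IsOppenheim P F φ y B)
    [IsProbabilityMeasure P] (hlam : IsGood lam)
    (hint : ∀ j, 1 ≤ j → ∀ n, 1 ≤ n → ∀ᵐ ω ∂P, ∃ m : ℤ,
      lam j * φ n (B n ω) + (lam j - 1) * Yvar y B n ω * φ n (B n ω) = m) :
    iIndepFun (fun k ω => index lam (R φ y B (k + 1) ω)) P := by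
  refine iIndepFun_of_indepFun_prefix
    (fun n => MeasurableSpace.comap (digits B (n + 1)) inferInstance) ?_ ?_
  · intro i n hin
    obtain ⟨G, hG⟩ := index_R_eq_comp_digits (φ := φ) (y := y) (B := B) (lam := lam)
      (i := i + 1) (n := n + 1) (by omega) (by omega)
    simp only [hG]
    exact (Measurable.of_discrete (f := G)).comp (comap_measurable _)
  · intro n
    exact hR.indepFun_digits_index hlam hint (by omega)

end Law

/-! ### The truncated mean -/

/-- The survival function `s ↦ P(X_n > s)` of the discretized sequence. -/
def survival (F : ℝ → ℝ) (lam : ℕ → ℝ) (s : ℝ) : ℝ := tail F lam (index lam s - 1)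

/-- Write `X 1_{X ≤ t} = min X t - t 1_{X > t}` and apply the layer-cake formula to `min X t`. -/
theorem integral_indicator_le_eq {Ω : Type*} [MeasurableSpace Ω] {P : Measure Ω}
    [IsProbabilityMeasure P] {X : Ω → ℝ} {Q : ℝ → ℝ} (hX : Measurable X) (hX0 : ∀ ω, 0 ≤ X ω)
    (hQ : ∀ s, 0 ≤ s → P.real {ω | s < X ω} = Q s) {t : ℝ} (ht : 0 ≤ t) :
    ∫ ω, {ω | X ω ≤ t}.indicator X ω ∂P = (∫ s in (0 : ℝ)..t, Q s) - t * Q t := by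
  have hpt : ∀ ω, {ω | X ω ≤ t}.indicator X ω =
      min (X ω) t - {ω | t < X ω}.indicator (fun _ => t) ω := by
    intro ω
    by_cases h : X ω ≤ t
    · simp [Set.indicator, h, not_lt.mpr h]
    · simp [Set.indicator, h, not_le.mp h, (not_le.mp h).le]
  have hmin : Integrable (fun ω => min (X ω) t) P :=
    Integrable.of_mem_Icc 0 t (hX.min measurable_const).aemeasurable
      (ae_of_all _ fun ω => ⟨le_min (hX0 ω) ht, min_le_right _ _⟩)
  have hms : MeasurableSet {ω | t < X ω} := measurableSet_lt measurable_const hX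
  simp only [hpt]
  rw [integral_sub hmin ((integrable_const t).indicator hms), integral_indicator_const _ hms,
    hQ t ht, hmin.integral_eq_integral_meas_lt (ae_of_all _ fun ω => le_min (hX0 ω) ht),
    smul_eq_mul, mul_comm t]
  congr 1
  have h1 : ∀ s ∈ Set.Ioi (0 : ℝ), P.real {ω | s < min (X ω) t} = (Set.Iio t).indicator Q s := by
    intro s hs
    by_cases h : s < t
    · simp only [lt_min_iff, h, and_true, Set.indicator, Set.mem_Iio, if_true]
      exact hQ s (le_of_lt hs)
    · simp [h, Set.indicator]
  rw [setIntegral_congr_fun measurableSet_Ioi h1, setIntegral_indicator measurableSet_Iio,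
    intervalIntegral.integral_of_le ht, integral_Ioc_eq_integral_Ioo]
  rfl

theorem tendsto_integral_div_log {Q : ℝ → ℝ} {α : ℝ}
    (hQ : ∀ a b, 0 ≤ a → a ≤ b → IntervalIntegrable Q volume a b)
    (h : Tendsto (fun s => s * Q s) atTop (𝓝 α)) :
    Tendsto (fun t => (∫ s in (0 : ℝ)..t, Q s) / Real.log t) atTop (𝓝 α) := by
  rw [Metric.tendsto_atTop]
  intro ε hε
  obtain ⟨S₀, hS₀⟩ := Metric.tendsto_atTop.mp h (ε / 2) (by positivity)
  set S := max S₀ 1 with hS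
  have hS1 : 1 ≤ S := le_max_right _ _
  set D := (∫ s in (0 : ℝ)..S, Q s) - α * Real.log S with hD
  -- Beyond `S`, `Q s` is within `(ε / 2) / s` of `α / s`; the choice of `T` makes the fixed
  -- contribution `D` of `[0, S]` small against `ε log t`.
  obtain ⟨T, hT⟩ := (tendsto_atTop_atTop.mp Real.tendsto_log_atTop) (4 * |D| / ε + 1)
  refine ⟨max T S, fun t ht => ?_⟩
  have htS : S ≤ t := (le_max_right _ _).trans ht
  have hlog := hT t ((le_max_left _ _).trans ht)
  have hlog0 : 0 < Real.log t := lt_of_lt_of_le (by positivity) hlog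
  have hS0 : 0 < S := by linarith
  have ht0 : 0 < t := by linarith
  have hinv : IntervalIntegrable (fun s : ℝ => s⁻¹) volume S t := by
    refine intervalIntegral.intervalIntegrable_inv (fun x hx => ?_) continuousOn_id
    rw [Set.uIcc_of_le htS] at hx
    exact (by linarith [hx.1] : (0 : ℝ) < x).ne'
  have hint : ∀ c : ℝ, ∫ s in S..t, c * s⁻¹ = c * (Real.log t - Real.log S) := by
    intro c
    rw [intervalIntegral.integral_const_mul, integral_inv_of_pos hS0 ht0,
      Real.log_div ht0.ne' hS0.ne']
  have hpt : ∀ s ∈ Set.Icc S t, (α - ε / 2) * s⁻¹ ≤ Q s ∧ Q s ≤ (α + ε / 2) * s⁻¹ := by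
    intro s hs
    have hs0 : 0 < s := by linarith [hs.1]
    have := hS₀ s ((le_max_left _ _).trans hs.1)
    rw [Real.dist_eq, abs_lt] at this
    rw [← div_eq_mul_inv, ← div_eq_mul_inv, div_le_iff₀ hs0, le_div_iff₀ hs0]
    constructor <;> linarith [this.1, this.2, mul_comm s (Q s)]
  have hlo := intervalIntegral.integral_mono_on htS (hinv.const_mul (α - ε / 2)) (hQ S t hS0.le htS)
    (fun s hs => (hpt s hs).1)
  have hhi := intervalIntegral.integral_mono_on htS (hQ S t hS0.le htS) (hinv.const_mul (α + ε / 2))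
    (fun s hs => (hpt s hs).2)
  rw [hint] at hlo hhi
  have hadd := intervalIntegral.integral_add_adjacent_intervals (hQ 0 S le_rfl hS0.le)
    (hQ S t hS0.le htS)
  have hlS : 0 ≤ Real.log S := Real.log_nonneg hS1
  have hDlog : 2 * |D| < ε / 2 * Real.log t := by
    have : ε / 2 * (4 * |D| / ε + 1) ≤ ε / 2 * Real.log t := by gcongr
    have h2 : ε / 2 * (4 * |D| / ε + 1) = 2 * |D| + ε / 2 := by field_simp; ring
    linarith
  have hD1 := le_abs_self D
  have hD2 := neg_abs_le D
  have hD0 := abs_nonneg D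
  have hεS : 0 ≤ ε / 2 * Real.log S := by positivity
  rw [Real.dist_eq, div_sub' hlog0.ne', abs_div, abs_of_pos hlog0, div_lt_iff₀ hlog0, abs_lt,
    ← hadd]
  constructor <;> nlinarith

/-! ### Tail asymptotics of the discretized variables -/

section Survival

variable {F : ℝ → ℝ} {lam : ℕ → ℝ}

/-- If `λ_j ≤ s < λ_{j+1}`, then `s - l ≤ λ_j ≤ s`. -/
theorem survival_bounds (hF : Monotone F) (hlam : IsGood lam) {l : ℝ}
    (hl : ∀ j, lam (j + 1) - lam j ≤ l) {s : ℝ} (hs : 0 ≤ s) :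
    F (1 / max 1 s) ≤ survival F lam s ∧ survival F lam s ≤ F (1 / max 1 (s - l)) := by
  have hi : 0 < index lam s := (hlam.lt_index_iff 0 s).mpr (hlam.zero.le.trans hs)
  obtain ⟨j, hj⟩ : ∃ j, index lam s = j + 1 := ⟨index lam s - 1, by omega⟩
  have h := (hlam.index_eq_iff s j).mp hj
  have h3 := hl j
  simp only [survival, tail, hj, Nat.add_sub_cancel]
  constructor <;> apply hF <;> apply one_div_le_one_div_of_le (by positivity) <;>
    apply max_le_max_left <;> linarith [h.1, h.2]

theorem antitone_survival (hF : Monotone F) (hlam : IsGood lam) :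
    Antitone (survival F lam) := by
  intro s t hst
  have : index lam s ≤ index lam t := by
    by_contra hc
    push Not at hc
    rw [hlam.lt_index_iff] at hc
    have h2 : index lam t < index lam t := (hlam.lt_index_iff _ _).mpr (hc.trans hst)
    exact lt_irrefl _ h2
  simp only [survival, tail]
  exact hF (one_div_le_one_div_of_le (by positivity)
    (max_le_max_left _ (hlam.strictMono.monotone (by omega))))

theorem eventually_mul_survival_le (hF : Monotone F) (hlam : IsGood lam) {C : ℝ}
    (hC0 : 0 ≤ C) (hC : ∀ x, 0 < x → x ≤ 1 → F x ≤ C * x) :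
    ∀ᶠ t : ℝ in atTop, t * survival F lam t ≤ 2 * C := by
  obtain ⟨l, hl⟩ := hlam.gaps
  -- `t ≥ 2 l` gives `t / (t - l) ≤ 2`; `t ≥ l + 1` puts `1 / (t - l)` in `(0, 1]`.
  filter_upwards [eventually_ge_atTop (2 * l), eventually_ge_atTop (l + 1),
    eventually_ge_atTop 0] with t h1 h2 h3
  have h4 := (survival_bounds hF hlam hl h3).2
  rw [max_eq_right (by linarith)] at h4
  have h5 : 0 < t - l := by linarith
  have h6 := hC (1 / (t - l)) (by positivity) (by rw [div_le_one h5]; linarith)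
  calc t * survival F lam t ≤ t * (C * (1 / (t - l))) := by gcongr; exact h4.trans h6
    _ = C * (t / (t - l)) := by ring
    _ ≤ C * 2 := by
        gcongr
        rw [div_le_iff₀ h5]
        linarith
    _ = 2 * C := by ring

theorem tendsto_mul_survival (hF : Monotone F) (hlam : IsGood lam) {α : ℝ}
    (h : Tendsto (fun x : ℝ => F x / x) (𝓝[>] 0) (𝓝 α)) :
    Tendsto (fun t => t * survival F lam t) atTop (𝓝 α) := by
  obtain ⟨l, hl⟩ := hlam.gaps
  have hinv : Tendsto (fun t : ℝ => t * F (1 / t)) atTop (𝓝 α) := by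
    refine (h.comp tendsto_inv_atTop_nhdsGT_zero).congr fun t => ?_
    simp [mul_comm]
  have hsub : Tendsto (fun t : ℝ => t - l) atTop atTop := tendsto_atTop_add_const_right _ _ tendsto_id
  have hratio : Tendsto (fun t : ℝ => t / (t - l)) atTop (𝓝 1) := by
    have h1 : Tendsto (fun t : ℝ => 1 + l / (t - l)) atTop (𝓝 (1 + 0)) :=
      (tendsto_const_nhds).add (hsub.const_div_atTop l)
    rw [add_zero] at h1
    refine h1.congr' ?_
    filter_upwards [eventually_gt_atTop l] with t ht
    have : t - l ≠ 0 := by linarith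
    field_simp
    ring
  have hupper : Tendsto (fun t : ℝ => t * F (1 / (t - l))) atTop (𝓝 α) := by
    have h2 := hratio.mul (hinv.comp hsub)
    rw [one_mul] at h2
    refine h2.congr' ?_
    filter_upwards [eventually_gt_atTop l] with t ht
    have : t - l ≠ 0 := by linarith
    simp only [Function.comp_apply]
    field_simp
  refine tendsto_of_tendsto_of_tendsto_of_le_of_le' hinv hupper ?_ ?_
  · filter_upwards [eventually_ge_atTop 1] with t ht
    have := (survival_bounds hF hlam hl (zero_le_one.trans ht)).1
    rw [max_eq_right ht] at this
    gcongr
  · filter_upwards [eventually_ge_atTop (l + 1), eventually_ge_atTop 0] with t h1 h2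
    have := (survival_bounds hF hlam hl h2).2
    rw [max_eq_right (by linarith)] at this
    gcongr

theorem log_le_integral_survival (hF : Monotone F) (hF0 : F 0 = 0) (hlam : IsGood lam) {c : ℝ}
    (hc : ∀ x, 0 < x → x ≤ 1 → c * x ≤ F x) {t : ℝ} (ht : 1 ≤ t) :
    c * Real.log t ≤ ∫ s in (0 : ℝ)..t, survival F lam s := by
  obtain ⟨l, hl⟩ := hlam.gaps
  have hQ : ∀ a b, IntervalIntegrable (survival F lam) volume a b := fun a b =>
    (antitone_survival hF hlam).intervalIntegrable
  rw [← intervalIntegral.integral_add_adjacent_intervals (hQ 0 1) (hQ 1 t)]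
  have hinv : IntervalIntegrable (fun s : ℝ => s⁻¹) volume 1 t := by
    refine intervalIntegral.intervalIntegrable_inv (fun x hx => ?_) continuousOn_id
    rw [Set.uIcc_of_le ht] at hx
    exact (by linarith [hx.1] : (0 : ℝ) < x).ne'
  have h1 := intervalIntegral.integral_mono_on ht (hinv.const_mul c) (hQ 1 t) (fun s hs => by
    have hs0 : 0 < s := by linarith [hs.1]
    have h2 := (survival_bounds hF hlam hl hs0.le).1
    rw [max_eq_right hs.1, one_div] at h2
    exact (hc s⁻¹ (by positivity) (inv_le_one_of_one_le₀ hs.1)).trans h2)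
  rw [intervalIntegral.integral_const_mul, integral_inv_of_pos one_pos (by linarith), div_one] at h1
  have h0 : 0 ≤ ∫ s in (0 : ℝ)..1, survival F lam s := by
    refine intervalIntegral.integral_nonneg zero_le_one fun s _ => ?_
    have := hF (a := 0) (b := 1 / max 1 (lam (index lam s - 1))) (by positivity)
    rwa [hF0] at this
  linarith

end Survival

/-! ### The trimmed strong law -/

section StrongLaw

variable {Ω : Type*} [MeasurableSpace Ω] {P : Measure Ω} [IsProbabilityMeasure P] {F : ℝ → ℝ}
  {φ : ℕ → ℕ+ → ℝ} {y : (n : ℕ) → (Fin n → ℕ+) → ℝ} {B : ℕ → Ω → ℕ+} {lam : ℕ → ℝ}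

theorem IsOppenheim.eventually_sum_index_sub_integral_lt (hR : IsOppenheim P F φ y B)
    (hlam : IsGood lam)
    (hint : ∀ j, 1 ≤ j → ∀ n, 1 ≤ n → ∀ᵐ ω ∂P, ∃ m : ℤ,
      lam j * φ n (B n ω) + (lam j - 1) * Yvar y B n ω * φ n (B n ω) = m)
    {γ : ℝ} (hγ : γ < 1 / 2) (g : ℕ → ℕ → ℝ) (hg : ∀ n i : ℕ, g n i ∈ Set.Icc 0 ((n : ℝ) ^ γ)) :
    ∀ᵐ ω ∂P, ∀ᶠ n : ℕ in atTop,
      ∑ k ∈ Finset.Icc 1 n, g n (index lam (R φ y B k ω)) -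
        ∑ k ∈ Finset.Icc 1 n, ∫ ω, g n (index lam (R φ y B k ω)) ∂P < n := by
  have := eventually_sum_sub_integral_lt (P := P)
    (Z := fun n k ω => g n (index lam (R φ y B (k + 1) ω))) hγ
    (fun n k => (Measurable.of_discrete (f := g n)).comp (hR.measurable_index (by omega)))
    (fun n => (hR.iIndepFun_index hlam hint).comp (fun _ => g n)
      (fun _ => Measurable.of_discrete)) (fun n k ω => hg n _)
  filter_upwards [this] with ω hω
  filter_upwards [hω] with n hn
  rwa [sum_Icc_eq_sum_range (fun k => g n (index lam (R φ y B k ω))),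
    sum_Icc_eq_sum_range (fun k => ∫ ω, g n (index lam (R φ y B k ω)) ∂P)]

theorem IsOppenheim.real_lt_discretize (hR : IsOppenheim P F φ y B) (hlam : IsGood lam)
    (hint : ∀ j, 1 ≤ j → ∀ n, 1 ≤ n → ∀ᵐ ω ∂P, ∃ m : ℤ,
      lam j * φ n (B n ω) + (lam j - 1) * Yvar y B n ω * φ n (B n ω) = m)
    {n : ℕ} (hn : 1 ≤ n) {s : ℝ} (hs : 0 ≤ s) :
    P.real {ω | s < discretize lam (R φ y B) n ω} = survival F lam s := by
  have hi : 0 < index lam s := (hlam.lt_index_iff 0 s).mpr (hlam.zero.le.trans hs)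
  have : {ω | s < discretize lam (R φ y B) n ω} =
      {ω | index lam s - 1 < index lam (R φ y B n ω)} := by
    ext ω
    have h := hlam.lt_index_iff (index lam (R φ y B n ω)) s
    simp only [Set.mem_ofPred_eq, discretize]
    rw [← not_le, ← h]
    omega
  rw [this, hR.real_lt_index_eq_tail hlam hint hn, survival]

theorem IsOppenheim.truncatedMean_eq (hR : IsOppenheim P F φ y B) (hlam : IsGood lam)
    (hint : ∀ j, 1 ≤ j → ∀ n, 1 ≤ n → ∀ᵐ ω ∂P, ∃ m : ℤ,
      lam j * φ n (B n ω) + (lam j - 1) * Yvar y B n ω * φ n (B n ω) = m) (γ : ℝ) (n : ℕ) :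
    truncatedMean P (discretize lam (R φ y B)) γ n =
      n * ((∫ s in (0 : ℝ)..(n : ℝ) ^ γ, survival F lam s) -
        (n : ℝ) ^ γ * survival F lam ((n : ℝ) ^ γ)) := by
  rw [truncatedMean, Finset.sum_congr rfl fun k hk => integral_indicator_le_eq
    (hR.measurable_discretize (Finset.mem_Icc.mp hk).1) (fun ω => hlam.nonneg _)
    (fun s hs => hR.real_lt_discretize hlam hint (Finset.mem_Icc.mp hk).1 hs)
    (Real.rpow_nonneg (Nat.cast_nonneg n) γ)]
  simp [mul_sub]

/-- The deterministic half of the argument. Exceedances are weighted by `t`, so that `c ≤ m * t`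
says there are at most `m` of them. -/
theorem sub_trimmedSum_bounds {r x : ℕ → ℝ} {n m : ℕ} {l t c : ℝ} (ht : 0 < t) (hl : 0 ≤ l)
    (hr0 : ∀ k, 1 ≤ k → 0 ≤ r k) (hrx : ∀ k, 1 ≤ k → r k ≤ x k) (hxr : ∀ k, 1 ≤ k → x k ≤ r k + l)
    (hcm : c ≤ m * t) (hm : ∑ k ∈ Finset.Icc 1 n, (if t < x k then t else 0) ≤ c) :
    ∑ k ∈ Finset.Icc 1 n, (if x k ≤ t then x k else 0) - (n * l + m * t) ≤ trimmedSum r n m ∧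
      trimmedSum r n m ≤ ∑ k ∈ Finset.Icc 1 n, (if x k ≤ t then x k else 0) + c := by
  have hcount : ∑ k ∈ Finset.Icc 1 n, (if t < r k then (1 : ℝ) else 0) ≤ m := by
    have h1 : ∑ k ∈ Finset.Icc 1 n, (if t < r k then (1 : ℝ) else 0) * t ≤
        ∑ k ∈ Finset.Icc 1 n, (if t < x k then t else 0) := by
      refine Finset.sum_le_sum fun k hk => ?_
      have := hrx k (Finset.mem_Icc.mp hk).1
      split_ifs <;> linarith
    rw [← Finset.sum_mul] at h1
    exact le_of_mul_le_mul_right (h1.trans (hm.trans hcm)) ht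
  obtain ⟨h1, h2⟩ := trimmedSum_bounds ht.le hr0 hcount
  have h3 : ∑ k ∈ Finset.Icc 1 n, (if x k ≤ t then x k else 0) ≤
      ∑ k ∈ Finset.Icc 1 n, ((if r k ≤ t then r k else 0) + l) := by
    refine Finset.sum_le_sum fun k hk => ?_
    have a := hrx k (Finset.mem_Icc.mp hk).1
    have b := hxr k (Finset.mem_Icc.mp hk).1
    have c := hr0 k (Finset.mem_Icc.mp hk).1
    split_ifs <;> linarith
  -- A term with `r k ≤ t < x k` is lost on truncating `x`; its value is at most `t`, which the
  -- exceedance sum pays for.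
  have h4 : ∑ k ∈ Finset.Icc 1 n, (if r k ≤ t then r k else 0) ≤
      ∑ k ∈ Finset.Icc 1 n, ((if x k ≤ t then x k else 0) + (if t < x k then t else 0)) := by
    refine Finset.sum_le_sum fun k hk => ?_
    have a := hrx k (Finset.mem_Icc.mp hk).1
    have c := hr0 k (Finset.mem_Icc.mp hk).1
    split_ifs <;> linarith
  rw [Finset.sum_add_distrib] at h3 h4
  simp only [Finset.sum_const, Nat.card_Icc, Nat.add_sub_cancel, nsmul_eq_mul] at h3
  constructor <;> linarith

/-- The one-sided concentration bound is used three times: for the truncated variable `g`, for `n ^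
γ - g` (the lower deviation), and for the weighted exceedance `e`. -/
theorem IsOppenheim.eventually_abs_trimmedSum_sub_le (hR : IsOppenheim P F φ y B)
    (hlam : IsGood lam)
    (hint : ∀ j, 1 ≤ j → ∀ n, 1 ≤ n → ∀ᵐ ω ∂P, ∃ m : ℤ,
      lam j * φ n (B n ω) + (lam j - 1) * Yvar y B n ω * φ n (B n ω) = m)
    {C : ℝ} (hC0 : 0 ≤ C) (hC : ∀ x, 0 < x → x ≤ 1 → F x ≤ C * x) {γ β : ℝ} (hγ0 : 0 < γ)
    (hγ : γ < 1 / 2) (hβ : 1 + 2 * C < β) :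
    ∃ K : ℝ, ∀ᵐ ω ∂P, ∀ᶠ n : ℕ in atTop,
      |trimmedSum (fun k => R φ y B k ω) n (trimming β γ n) -
        truncatedMean P (discretize lam (R φ y B)) γ n| ≤ K * n := by
  obtain ⟨l, hl⟩ := hlam.gaps
  have hl0 : 0 ≤ l := (sub_nonneg.mpr (hlam.strictMono (Nat.lt_succ_self 0)).le).trans (hl 0)
  have hpow0 : ∀ n : ℕ, 0 ≤ (n : ℝ) ^ γ := fun n => Real.rpow_nonneg (Nat.cast_nonneg n) γ
  let g : ℕ → ℕ → ℝ := fun n i => if lam i ≤ (n : ℝ) ^ γ then lam i else 0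
  have hg : ∀ n i : ℕ, g n i ∈ Set.Icc 0 ((n : ℝ) ^ γ) := by
    intro n i
    simp only [g, Set.mem_Icc]
    split_ifs with h
    · exact ⟨hlam.nonneg i, h⟩
    · exact ⟨le_rfl, hpow0 n⟩
  have hg' : ∀ n i : ℕ, (n : ℝ) ^ γ - g n i ∈ Set.Icc 0 ((n : ℝ) ^ γ) := fun n i =>
    ⟨sub_nonneg.mpr (hg n i).2, sub_le_self _ (hg n i).1⟩
  let e : ℕ → ℕ → ℝ := fun n i => if (n : ℝ) ^ γ < lam i then (n : ℝ) ^ γ else 0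
  have he : ∀ n i : ℕ, e n i ∈ Set.Icc 0 ((n : ℝ) ^ γ) := by
    intro n i
    simp only [e, Set.mem_Icc]
    split_ifs with h
    · exact ⟨hpow0 n, le_rfl⟩
    · exact ⟨le_rfl, hpow0 n⟩
  have hmean : ∀ n : ℕ, ∑ k ∈ Finset.Icc 1 n, ∫ ω, g n (index lam (R φ y B k ω)) ∂P =
      truncatedMean P (discretize lam (R φ y B)) γ n := fun n => rfl
  have hmean' : ∀ n : ℕ,
      ∑ k ∈ Finset.Icc 1 n, ∫ ω, ((n : ℝ) ^ γ - g n (index lam (R φ y B k ω))) ∂P =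
      n * (n : ℝ) ^ γ - truncatedMean P (discretize lam (R φ y B)) γ n := by
    intro n
    rw [← hmean, Finset.sum_congr rfl (g := fun k => (n : ℝ) ^ γ -
      ∫ ω, g n (index lam (R φ y B k ω)) ∂P), Finset.sum_sub_distrib]
    · simp
    · intro k hk
      rw [integral_sub (integrable_const _)]
      · simp
      · exact Integrable.of_mem_Icc 0 ((n : ℝ) ^ γ) ((Measurable.of_discrete (f := g n)).comp
          (hR.measurable_index (Finset.mem_Icc.mp hk).1)).aemeasurable (ae_of_all _ fun ω => hg n _)
  have hexc : ∀ n : ℕ, ∑ k ∈ Finset.Icc 1 n, ∫ ω, e n (index lam (R φ y B k ω)) ∂P =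
      n * ((n : ℝ) ^ γ * survival F lam ((n : ℝ) ^ γ)) := by
    intro n
    rw [Finset.sum_congr rfl (g := fun _ => (n : ℝ) ^ γ * survival F lam ((n : ℝ) ^ γ))]
    · simp
    · intro k hk
      have hk1 := (Finset.mem_Icc.mp hk).1
      have : (fun ω => e n (index lam (R φ y B k ω))) =
          {ω | (n : ℝ) ^ γ < discretize lam (R φ y B) k ω}.indicator (fun _ => (n : ℝ) ^ γ) := rfl
      rw [this, integral_indicator_const _
        (measurableSet_lt measurable_const (hR.measurable_discretize hk1)),
        hR.real_lt_discretize hlam hint hk1 (hpow0 n), smul_eq_mul, mul_comm]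
  have hpow : Tendsto (fun n : ℕ => (n : ℝ) ^ γ) atTop atTop :=
    (tendsto_rpow_atTop hγ0).comp tendsto_natCast_atTop_atTop
  have hsurv := hpow.eventually (eventually_mul_survival_le hR.distribution.mono hlam hC0 hC)
  -- `1` for the fluctuation, `l` for replacing `X_k` by `R_k`, `β + 1` for the trimmed terms, as
  -- `r_n n ^ γ ≤ (β + 1) n`.
  refine ⟨1 + l + (β + 1), ?_⟩
  filter_upwards [hR.eventually_sum_index_sub_integral_lt hlam hint hγ g hg,
    hR.eventually_sum_index_sub_integral_lt hlam hint hγ (fun n i => (n : ℝ) ^ γ - g n i) hg',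
    hR.eventually_sum_index_sub_integral_lt hlam hint hγ e he] with ω h1 h2 h3
  filter_upwards [h1, h2, h3, hsurv, eventually_ge_atTop 1] with n h1 h2 h3 h4 hn
  rw [hmean] at h1
  rw [hmean', Finset.sum_sub_distrib] at h2
  simp only [Finset.sum_const, Nat.card_Icc, Nat.add_sub_cancel, nsmul_eq_mul] at h2
  rw [hexc] at h3
  have hn0 : (0 : ℝ) < n := by exact_mod_cast hn
  have hn1 : (1 : ℝ) ≤ n := by exact_mod_cast hn
  have ht0 : 0 < (n : ℝ) ^ γ := Real.rpow_pos_of_pos hn0 γ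
  have hsplit : (n : ℝ) ^ (1 - γ) * (n : ℝ) ^ γ = n := by
    rw [← Real.rpow_add hn0]
    simp
  have htn : (n : ℝ) ^ γ ≤ n := by
    simpa using Real.rpow_le_rpow_of_exponent_le hn1 (by linarith : γ ≤ 1)
  have hβ0 : 0 ≤ β * (n : ℝ) ^ (1 - γ) := mul_nonneg (by linarith) (Real.rpow_nonneg hn0.le _)
  have hr1 : β * n ≤ (trimming β γ n : ℝ) * (n : ℝ) ^ γ := by
    have := mul_le_mul_of_nonneg_right (Nat.le_ceil (β * (n : ℝ) ^ (1 - γ))) ht0.le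
    rwa [mul_assoc, hsplit] at this
  have hr2 : (trimming β γ n : ℝ) * (n : ℝ) ^ γ ≤ (β + 1) * n := by
    have := mul_le_mul_of_nonneg_right (Nat.ceil_lt_add_one hβ0).le ht0.le
    rw [add_mul, mul_assoc, hsplit, one_mul] at this
    have e1 : (trimming β γ n : ℝ) * (n : ℝ) ^ γ ≤ β * n + (n : ℝ) ^ γ := this
    linarith
  have hgap : ∀ k, 1 ≤ k → R φ y B k ω ≤ discretize lam (R φ y B) k ω ∧
      discretize lam (R φ y B) k ω ≤ R φ y B k ω + l := by
    intro k hk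
    have hi : 0 < index lam (R φ y B k ω) :=
      (hlam.lt_index_iff 0 _).mpr (hlam.zero.le.trans (hR.R_pos hk ω).le)
    obtain ⟨j, hj⟩ : ∃ j, index lam (R φ y B k ω) = j + 1 :=
      ⟨index lam (R φ y B k ω) - 1, by omega⟩
    have h := (hlam.index_eq_iff _ j).mp hj
    have h' := hl j
    rw [discretize, hj]
    constructor <;> linarith [h.1, h.2]
  -- In `c`, `2 C n` bounds the mean of the weighted exceedances and `n` their fluctuation.
  have hmain := sub_trimmedSum_bounds (r := fun k => R φ y B k ω)
    (x := fun k => discretize lam (R φ y B) k ω) (n := n) (m := trimming β γ n) (l := l)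
    (t := (n : ℝ) ^ γ) (c := (1 + 2 * C) * n) ht0 hl0 (fun k hk => (hR.R_pos hk ω).le)
    (fun k hk => (hgap k hk).1) (fun k hk => (hgap k hk).2)
    ((mul_le_mul_of_nonneg_right hβ.le hn0.le).trans hr1) (by
      have : (n : ℝ) * ((n : ℝ) ^ γ * survival F lam ((n : ℝ) ^ γ)) ≤ n * (2 * C) := by gcongr
      have h5 : ∑ k ∈ Finset.Icc 1 n, e n (index lam (R φ y B k ω)) ≤ (1 + 2 * C) * n := by linarith
      exact h5)
  obtain ⟨h6, h7⟩ := hmain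
  change ∑ k ∈ Finset.Icc 1 n, g n (index lam (R φ y B k ω)) - _ ≤ _ at h6
  change _ ≤ ∑ k ∈ Finset.Icc 1 n, g n (index lam (R φ y B k ω)) + _ at h7
  have h8 : (1 + 2 * C) * n ≤ β * n := mul_le_mul_of_nonneg_right hβ.le hn0.le
  have h9 : 0 ≤ l * n := by positivity
  rw [abs_le]
  constructor <;> linarith

end StrongLaw

/-! ### From an error of order `n` to the limits -/

theorem exists_le_mul_of_tendsto {F : ℝ → ℝ} (hF : Monotone F) (hF1 : F 1 = 1) {α : ℝ}
    (hα : 0 < α) (h : Tendsto (fun x : ℝ => F x / x) (𝓝[>] 0) (𝓝 α)) :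
    ∃ C : ℝ, 0 ≤ C ∧ ∀ x, 0 < x → x ≤ 1 → F x ≤ C * x := by
  have h1 := h.eventually (eventually_le_nhds (lt_add_one α))
  obtain ⟨ε, hε, hs⟩ := mem_nhdsGT_iff_exists_Ioo_subset.mp h1
  have hε0 : (0 : ℝ) < ε := hε
  -- The limit controls `x < ε`; for `x ≥ ε`, `F x ≤ 1 ≤ x / ε`.
  refine ⟨α + 1 + 1 / ε, by positivity, fun x hx0 hx1 => ?_⟩
  rcases lt_or_ge x ε with hx | hx
  · have : F x / x ≤ α + 1 := hs ⟨hx0, hx⟩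
    rw [div_le_iff₀ hx0] at this
    have h2 : 0 ≤ 1 / ε * x := by positivity
    linarith
  · have h2 : F x ≤ 1 := hF1 ▸ hF hx1
    have h3 : 1 ≤ 1 / ε * x := by rwa [one_div, ← div_eq_inv_mul, one_le_div hε0]
    have h4 : 0 ≤ (α + 1) * x := by positivity
    linarith

theorem tendsto_div_of_abs_sub_le {S d M : ℕ → ℝ} {K : ℝ} (hd : ∀ n, d n = n * M n)
    (hM : Tendsto M atTop atTop) (h : ∀ᶠ n : ℕ in atTop, |S n - d n| ≤ K * n) :
    Tendsto (fun n => S n / d n) atTop (𝓝 1) := by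
  rw [tendsto_iff_norm_sub_tendsto_zero]
  refine squeeze_zero' (Eventually.of_forall fun n => norm_nonneg _) ?_ (hM.const_div_atTop K)
  filter_upwards [h, hM.eventually_gt_atTop 0, eventually_gt_atTop 0] with n h1 h2 h3
  have hn0 : (0 : ℝ) < n := by exact_mod_cast h3
  have hd0 : 0 < d n := by rw [hd]; positivity
  rw [div_sub_one hd0.ne', Real.norm_eq_abs, abs_div, abs_of_pos hd0, div_le_div_iff₀ hd0 h2, hd n]
  rw [hd n] at h1
  nlinarith

end Oppenheim

end

theorem theorem4p2 {Ω : Type*} [MeasurableSpace Ω] (P : Measure Ω) [IsProbabilityMeasure P]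
    (F : ℝ → ℝ) (φ : ℕ → ℕ+ → ℝ) (y : (n : ℕ) → (Fin n → ℕ+) → ℝ) (B : ℕ → Ω → ℕ+)
    (hR : Oppenheim.IsOppenheim P F φ y B)
    (lam : ℕ → ℝ) (hlam : Oppenheim.IsGood lam)
    (hint : ∀ j, 1 ≤ j → ∀ n, 1 ≤ n → ∀ᵐ ω ∂P, ∃ m : ℤ,
      lam j * φ n (B n ω) + (lam j - 1) * Oppenheim.Yvar y B n ω * φ n (B n ω) = m) :
    ∃ C : ℝ, 0 < C ∧
      ((∃ C₁ C₂ : ℝ, 0 < C₁ ∧ C₁ < C₂ ∧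
          ∀ x : ℝ, 0 < x → x ≤ 1 → C₁ ≤ F x / x ∧ F x / x ≤ C₂) →
        ∀ γ β : ℝ, 0 < γ → γ < 1 / 2 → C < β →
          ∀ᵐ ω ∂P, Tendsto (fun n : ℕ =>
            Oppenheim.trimmedSum (fun k => Oppenheim.R φ y B k ω) n (Oppenheim.trimming β γ n) /
              Oppenheim.truncatedMean P
                (Oppenheim.discretize lam (Oppenheim.R φ y B)) γ n) atTop (𝓝 1)) ∧
      (∀ α : ℝ, 0 < α → Tendsto (fun x : ℝ => F x / x) (𝓝[>] 0) (𝓝 α) →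
        ∀ γ β : ℝ, 0 < γ → γ < 1 / 2 → C < β →
          ∀ᵐ ω ∂P, Tendsto (fun n : ℕ =>
            Oppenheim.trimmedSum (fun k => Oppenheim.R φ y B k ω) n (Oppenheim.trimming β γ n) /
              ((n : ℝ) * Real.log n)) atTop (𝓝 (α * γ))) := by
  -- One constant must serve both parts before either hypothesis is available. Each hypothesis
  -- implies a linear bound on `F`, so without one both parts are vacuous.
  by_cases hbd : ∃ C : ℝ, 0 ≤ C ∧ ∀ x, 0 < x → x ≤ 1 → F x ≤ C * x
  swap
  · refine ⟨1, one_pos, ?_, ?_⟩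
    · rintro ⟨C₁, C₂, h1, h2, h⟩
      refine absurd ⟨C₂, by linarith, fun x hx0 hx1 => ?_⟩ hbd
      exact (div_le_iff₀ hx0).mp (h x hx0 hx1).2
    · intro α hα h
      exact absurd
        (Oppenheim.exists_le_mul_of_tendsto hR.distribution.mono hR.F_one hα h) hbd
  obtain ⟨C, hC0, hC⟩ := hbd
  have hmono := hR.distribution.mono
  refine ⟨1 + 2 * C, by positivity, ?_, ?_⟩
  · rintro ⟨C₁, C₂, hC₁, -, hF⟩ γ β hγ0 hγ hβ
    obtain ⟨K, hK⟩ := hR.eventually_abs_trimmedSum_sub_le hlam hint hC0 hC hγ0 hγ hβ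
    filter_upwards [hK] with ω hω
    refine Oppenheim.tendsto_div_of_abs_sub_le (hR.truncatedMean_eq hlam hint γ) ?_ hω
    have hpow : Tendsto (fun n : ℕ => (n : ℝ) ^ γ) atTop atTop :=
      (tendsto_rpow_atTop hγ0).comp tendsto_natCast_atTop_atTop
    refine Tendsto.comp (g := fun t : ℝ => (∫ s in (0 : ℝ)..t, Oppenheim.survival F lam s) -
      t * Oppenheim.survival F lam t) ?_ hpow
    refine tendsto_atTop_mono' atTop (f₁ := fun t => C₁ * Real.log t + -(2 * C)) ?_
      (tendsto_atTop_add_const_right _ _ (Real.tendsto_log_atTop.const_mul_atTop hC₁))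
    filter_upwards [eventually_ge_atTop 1,
      Oppenheim.eventually_mul_survival_le hmono hlam hC0 hC] with t ht h1
    have h2 := Oppenheim.log_le_integral_survival hmono hR.F_zero hlam
      (fun x hx0 hx1 => (le_div_iff₀ hx0).mp (hF x hx0 hx1).1) ht
    linarith
  · intro α hα hF γ β hγ0 hγ hβ
    obtain ⟨K, hK⟩ := hR.eventually_abs_trimmedSum_sub_le hlam hint hC0 hC hγ0 hγ hβ
    have hpow : Tendsto (fun n : ℕ => (n : ℝ) ^ γ) atTop atTop :=
      (tendsto_rpow_atTop hγ0).comp tendsto_natCast_atTop_atTop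
    have hlog : Tendsto (fun n : ℕ => Real.log n) atTop atTop :=
      Real.tendsto_log_atTop.comp tendsto_natCast_atTop_atTop
    have hts := Oppenheim.tendsto_mul_survival hmono hlam hF
    have hI := Oppenheim.tendsto_integral_div_log (Q := Oppenheim.survival F lam)
      (fun a b _ _ => (Oppenheim.antitone_survival hmono hlam).intervalIntegrable) hts
    -- The boundary term `t Q(t)` is bounded, hence negligible against `log t`; the factor `γ` comes
    -- from `log (n ^ γ) = γ log n`.
    have h1 := ((hI.sub (hts.div_atTop Real.tendsto_log_atTop)).comp hpow).mul_const γ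
    rw [sub_zero] at h1
    filter_upwards [hK] with ω hω
    have h2 : Tendsto (fun n : ℕ => (Oppenheim.trimmedSum (fun k => Oppenheim.R φ y B k ω) n
        (Oppenheim.trimming β γ n) - Oppenheim.truncatedMean P
          (Oppenheim.discretize lam (Oppenheim.R φ y B)) γ n) / (n * Real.log n)) atTop (𝓝 0) := by
      refine squeeze_zero_norm' ?_ (hlog.const_div_atTop K)
      filter_upwards [hω, hlog.eventually_gt_atTop 0, eventually_gt_atTop 0] with n h3 h4 h5
      have hn0 : (0 : ℝ) < n := by exact_mod_cast h5
      rw [Real.norm_eq_abs, abs_div, abs_of_pos (mul_pos hn0 h4), div_le_div_iff₀ (by positivity) h4]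
      nlinarith
    have h6 := h2.add h1
    rw [zero_add] at h6
    refine h6.congr' ?_
    filter_upwards [hlog.eventually_gt_atTop 0, eventually_gt_atTop 0] with n h4 h5
    have hn0 : (0 : ℝ) < n := by exact_mod_cast h5
    simp only [Function.comp_apply]
    rw [hR.truncatedMean_eq hlam hint, Real.log_rpow hn0]
    field_simp
    ring
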